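/- Let $G$ be a finite simple graph with $n\ge 1$ vertices, and let $\lambda_1(G)\ge\lambda_2(G)\ge\dots\ge\lambda_n(G)$ be the eigenvalues (with multiplicity) of its adjacency matrix. The median eigenvalues of $G$ are $\lambda_h(G)$ and $\lambda_\ell(G)$, where $h=\lfloor\frac{n+1}{2}\rfloor$ and $\ell=\lceil\frac{n+1}{2}\rceil$, and the HL-index of $G$ is $R(G)=\max\{|\lambda_h(G)|,|\lambda_\ell(G)|\}$. The Heawood graph is the bipartite incidence graph of the points and lines of the Fano plane. Theorem. Let $G$ be a finite simple graph with at least one vertex that is bipartite and subcubic (that is, of maximum degree at most $3$). If every connected component of $G$ is isomorphic to the Heawood graph, then $R(G)=\lambda_h(G)=|\lambda_\ell(G)|=\sqrt2$. In any other case, both median eigenvalues $\lambda_h(G)$ and $\lambda_\ell(G)$ are contained in the interval $[-1,1]$, i.e., $R(G)\le 1$. -/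

import Mathlib

/-- The Heawood graph: the incidence graph of the points and lines of the Fano plane. The Fano plane
is given by its cyclic model: points (`Sum.inl`) and lines (`Sum.inr`) are indexed by `ZMod 7`, and
the line with index `j` consists of the three points `j`, `j + 1`, `j + 3`. -/
def heawoodGraph : SimpleGraph (ZMod 7 ⊕ ZMod 7) where
  Adj x y := match x, y with
    | Sum.inl p, Sum.inr j => p = j ∨ p = j + 1 ∨ p = j + 3
    | Sum.inr j, Sum.inl p => p = j ∨ p = j + 1 ∨ p = j + 3
    | _, _ => False
  symm := ⟨by rintro (p | j) (q | k) h <;> exact h⟩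
  loopless := ⟨by rintro (p | j) h <;> exact h⟩

section HLIndex

variable {V : Type*} [Fintype V] [DecidableEq V] (G : SimpleGraph V) [DecidableRel G.Adj]

/-- The `i`-th largest eigenvalue (`i = 1, …, n`, with multiplicity) of the real adjacency matrix of
a graph `G` on `n` vertices. (`eigenvalues₀` lists the eigenvalues in decreasing order, indexed from
`0`.) -/
noncomputable def SimpleGraph.adjEigenvalue (i : ℕ) (h1 : 1 ≤ i) (hn : i ≤ Fintype.card V) : ℝ :=
  (SimpleGraph.isHermitian_adjMatrix (R := ℝ) G).eigenvalues₀ ⟨i - 1, by omega⟩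

/-- The median eigenvalue `λ_h`, where `h = ⌊(n + 1) / 2⌋`. -/
noncomputable def SimpleGraph.medianH [Nonempty V] : ℝ :=
  G.adjEigenvalue ((Fintype.card V + 1) / 2)
    (by have := Fintype.card_pos (α := V); omega)
    (by have := Fintype.card_pos (α := V); omega)

/-- The median eigenvalue `λ_ℓ`, where `ℓ = ⌈(n + 1) / 2⌉ = ⌊(n + 2) / 2⌋`. -/
noncomputable def SimpleGraph.medianL [Nonempty V] : ℝ :=
  G.adjEigenvalue ((Fintype.card V + 2) / 2)
    (by have := Fintype.card_pos (α := V); omega)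
    (by have := Fintype.card_pos (α := V); omega)

/-- The HL-index `R(G) = max {|λ_h(G)|, |λ_ℓ(G)|}`. -/
noncomputable def SimpleGraph.hlIndex [Nonempty V] : ℝ :=
  max |G.medianH| |G.medianL|

end HLIndex

/-! A bipartite spectrum is symmetric about `0`, so the medians are `±μ`, with `μ ≥ 0` the least
modulus of an eigenvalue. If `μ > 1`, then `P = A ^ 2 - 1` is a positive definite integral matrix
with diagonal `deg - 1 ≤ 2`, whose off-diagonal entries count common neighbours. Short test vectors
show that distinct vertices share at most one neighbour and that `G` is cubic
(`degree_eq_three_of_posDef`). Then `P` is the Gram matrix of norm-2 vectors, and each row sums to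
`9 - 1 = 8`.

The central point is `Matrix.not_dualMinGeOne_of_rowSum`: no four of these vectors span a `D₄`
lattice. "Determinant at most `4`, dual minimum at least `1`" holds for `D₄` and survives adjoining
further non-orthogonal vectors until a whole component of `P` is reached; but there the all-ones
vector has eigenvalue `8`, so `8` divides a determinant in `[1, 4]`.

Claws and diamonds in the relation `Linked` are `D₄` Gram matrices, so they are excluded and
`Linked` is transitive on distinct vertices (`Linked.trans`). Reading adjacency as incidence, each
component is a projective plane of order `2`, hence Heawood. Conversely, the Heawood eigenvalues
satisfy `μ ^ 2 = 2` or `μ ^ 2 = 9`, and `μ = 3` cannot be the least modulus. -/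

/-! ### Spectral symmetry and the median eigenvalues. -/

theorem Antitone.eq_neg_rev {n : ℕ} {f : Fin n → ℝ} (hf : Antitone f)
    (h : Multiset.map f Finset.univ.val = Multiset.map (fun i => -f i) Finset.univ.val)
    (i : Fin n) : f i = -f i.rev := by
  have hg : Antitone (fun i : Fin n => -f i.rev) := fun a b hab =>
    neg_le_neg (hf (Fin.rev_le_rev.2 hab))
  have hmap : Multiset.map (fun i : Fin n => -f i.rev) Finset.univ.val =
      Multiset.map (fun i => -f i) Finset.univ.val := by
    have hrev : Multiset.map Fin.rev (Finset.univ : Finset (Fin n)).val = Finset.univ.val :=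
      congrArg Finset.val (Finset.map_univ_equiv (Fin.revPerm (n := n)))
    conv_rhs => rw [← hrev, Multiset.map_map]
    rfl
  have hperm : (List.ofFn f).Perm (List.ofFn fun i : Fin n => -f i.rev) := by
    rw [← Multiset.coe_eq_coe]
    have key : ∀ g : Fin n → ℝ, ((List.ofFn g : List ℝ) : Multiset ℝ) =
        Multiset.map g Finset.univ.val := by
      intro g
      rw [Fin.univ_val_map]
    rw [key, key, h, hmap]
  have := List.Perm.eq_of_pairwise' (r := (· ≥ ·)) (List.pairwise_ofFn.2 fun a b hab => hf hab.le)
    (List.pairwise_ofFn.2 fun a b hab => hg hab.le) hperm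
  exact congrFun (List.ofFn_injective this) i

namespace Matrix.IsHermitian

variable {n : Type*} [Fintype n] [DecidableEq n] {A : Matrix n n ℝ}

theorem posDef_sq_sub_of_eigenvalues (hA : A.IsHermitian) {c : ℝ} (h : ∀ i, c < hA.eigenvalues i ^ 2) :
    (A ^ 2 - c • (1 : Matrix n n ℝ)).PosDef := by
  have hD : (diagonal hA.eigenvalues ^ 2 - c • (1 : Matrix n n ℝ)).PosDef := by
    have : diagonal hA.eigenvalues ^ 2 - c • (1 : Matrix n n ℝ) =
        diagonal fun i => hA.eigenvalues i ^ 2 - c := by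
      rw [diagonal_pow, smul_one_eq_diagonal, diagonal_sub]; rfl
    rw [this]
    exact PosDef.diagonal fun i => sub_pos.2 (h i)
  have hspec := hA.spectral_theorem
  have : A ^ 2 - c • (1 : Matrix n n ℝ) = Unitary.conjStarAlgAut ℝ _ hA.eigenvectorUnitary
      (diagonal hA.eigenvalues ^ 2 - c • (1 : Matrix n n ℝ)) := by
    rw [map_sub, map_pow, map_smul, map_one]
    conv_lhs => rw [hspec]
    rfl
  rw [this, Unitary.conjStarAlgAut_apply]
  refine hD.mul_mul_conjTranspose_same (Matrix.vecMul_injective_of_isUnit ?_)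
  exact (Unitary.toUnits hA.eigenvectorUnitary).isUnit

theorem eigenvalues₀_eq_neg_rev (hA : A.IsHermitian) (h : A.charpoly = (-A).charpoly) (i : Fin (Fintype.card n)) :
    hA.eigenvalues₀ i = -hA.eigenvalues₀ i.rev := by
  refine hA.eigenvalues₀_antitone.eq_neg_rev ?_ i
  have h1 := hA.roots_charpoly_eq_eigenvalues₀
  have h2 : (-A).charpoly.roots = Multiset.map (fun i => -hA.eigenvalues₀ i) Finset.univ.val := by
    have hspec : -A = Unitary.conjStarAlgAut ℝ _ hA.eigenvectorUnitary
        (diagonal fun i => -hA.eigenvalues i) := by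
      conv_lhs => rw [hA.spectral_theorem]
      rw [← map_neg, ← diagonal_neg]
      rfl
    rw [hspec, Unitary.conjStarAlgAut_apply, charpoly_mul_comm, ← mul_assoc]
    rw [Unitary.coe_star_mul_self, one_mul, charpoly_diagonal, Polynomial.roots_prod _ _
      (Finset.prod_ne_zero_iff.2 fun i _ => Polynomial.X_sub_C_ne_zero _)]
    have hmap := congrArg (Multiset.map Neg.neg) (hA.roots_charpoly_eq_eigenvalues.symm.trans h1)
    simpa [Multiset.map_map, Function.comp_def] using hmap
  rw [← h, h1] at h2
  simpa using h2

end Matrix.IsHermitian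

namespace SimpleGraph

variable {V : Type*} [Fintype V] [DecidableEq V] {G : SimpleGraph V} [DecidableRel G.Adj]

/-- Conjugation by the diagonal `±1` matrix of a 2-colouring negates the adjacency matrix. -/
theorem IsBipartite.charpoly_adjMatrix_neg (hbip : G.IsBipartite) :
    (G.adjMatrix ℝ).charpoly = (-G.adjMatrix ℝ).charpoly := by
  obtain ⟨c⟩ := hbip
  set s : V → ℝ := fun v => if c v = 0 then 1 else -1 with hs
  have hss : Matrix.diagonal s * Matrix.diagonal s = 1 := by
    rw [Matrix.diagonal_mul_diagonal, ← Matrix.diagonal_one]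
    congr 1
    funext v
    by_cases h : c v = 0 <;> simp [hs, h]
  have hA : G.adjMatrix ℝ = Matrix.diagonal s * (-G.adjMatrix ℝ) * Matrix.diagonal s := by
    ext u v
    rw [Matrix.mul_diagonal, Matrix.diagonal_mul, Matrix.neg_apply, adjMatrix_apply]
    by_cases h : G.Adj u v
    · have hne : c u ≠ c v := c.valid h
      simp only [hs, h, if_true]
      split_ifs <;> first | (exfalso; omega) | norm_num
    · simp [h]
  conv_lhs => rw [hA, Matrix.charpoly_mul_comm, ← mul_assoc, hss, one_mul]

/-- The medians of a bipartite graph are opposite, and no eigenvalue is smaller in modulus. -/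
theorem IsBipartite.median_spec [Nonempty V] (hbip : G.IsBipartite) :
    0 ≤ G.medianH ∧ G.medianL = -G.medianH ∧
      (∃ i, (isHermitian_adjMatrix (R := ℝ) G).eigenvalues i = G.medianH) ∧
      ∀ i, G.medianH ≤ |(isHermitian_adjMatrix (R := ℝ) G).eigenvalues i| := by
  have hA := isHermitian_adjMatrix (R := ℝ) G
  have hcard := Fintype.card_pos (α := V)
  have hrev := hA.eigenvalues₀_eq_neg_rev hbip.charpoly_adjMatrix_neg
  have hanti := hA.eigenvalues₀_antitone
  let h : Fin (Fintype.card V) := ⟨(Fintype.card V + 1) / 2 - 1, by omega⟩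
  let l : Fin (Fintype.card V) := ⟨(Fintype.card V + 2) / 2 - 1, by omega⟩
  have hH : G.medianH = hA.eigenvalues₀ h := rfl
  have hL : G.medianL = hA.eigenvalues₀ l := rfl
  -- The zero-based median positions add up to `n - 1`. Moreover `l ≤ h + 1`, so every index is at
  -- most `h` or at least `l`.
  have hlrev : h.rev = l := by
    ext
    simp only [Fin.val_rev, h, l]
    omega
  have hhl : hA.eigenvalues₀ h = -hA.eigenvalues₀ l := hlrev ▸ hrev h
  have hle : hA.eigenvalues₀ l ≤ hA.eigenvalues₀ h :=
    hanti (Fin.mk_le_mk.2 (by omega))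
  refine ⟨by rw [hH]; linarith, by rw [hH, hL]; linarith, ?_, fun i => ?_⟩
  · refine ⟨Fintype.equivOfCardEq (Fintype.card_fin _) h, ?_⟩
    simp [Matrix.IsHermitian.eigenvalues, hH]
  · rw [hH]
    unfold Matrix.IsHermitian.eigenvalues
    generalize (Fintype.equivOfCardEq (Fintype.card_fin _)).symm i = j
    rcases le_or_gt j h with hj | hj
    · exact (hanti hj).trans (le_abs_self _)
    · have : l ≤ j := by
        rw [Fin.le_def]
        rw [Fin.lt_def] at hj
        simp only [h, l] at hj ⊢
        omega
      have := hanti this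
      exact le_trans (by linarith) (neg_le_abs _)

end SimpleGraph

/-! ### Lattices of small determinant and large dual minimum. -/

namespace Matrix

variable {ι : Type*} [Fintype ι] [DecidableEq ι]

/-- For the Gram matrix `M` of a lattice basis: the determinant is at most `4`, and every nonzero
vector of the dual lattice has norm at least `1`. -/
def DualMinGeOne (M : Matrix ι ι ℝ) : Prop :=
  M.det ≤ 4 ∧ ∀ z : ι → ℤ, z ≠ 0 → ∀ y : ι → ℝ, M *ᵥ y = (fun i => (z i : ℝ)) →
    1 ≤ ∑ i, (z i : ℝ) * y i

/-- With `c = M⁻¹β`, the Schur complement `s = 2 - β ⬝ᵥ c` satisfies `0 < s ≤ 1`, because `β` is a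
nonzero integer vector and so has dual norm at least `1`. Hence the determinant does not grow, and a
dual norm is the old one plus `t ^ 2 * s`. -/
theorem DualMinGeOne.fromBlocks {M : Matrix ι ι ℝ} (hM : M.PosDef) (h : M.DualMinGeOne)
    {b : ι → ℤ} (hb : b ≠ 0)
    (hM' : (Matrix.fromBlocks M (replicateCol Unit fun i => (b i : ℝ))
      (replicateRow Unit fun i => (b i : ℝ)) (of fun _ _ : Unit => (2 : ℝ))).PosDef) :
    (Matrix.fromBlocks M (replicateCol Unit fun i => (b i : ℝ))
      (replicateRow Unit fun i => (b i : ℝ)) (of fun _ _ : Unit => (2 : ℝ))).DualMinGeOne := by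
  set β : ι → ℝ := fun i => (b i : ℝ) with hβ
  have hdet : IsUnit M.det := hM.det_pos.ne'.isUnit
  have hsymm : Mᵀ = M := by simpa using hM.isHermitian.eq
  set c : ι → ℝ := M⁻¹ *ᵥ β with hc
  have hMc : M *ᵥ c = β := by rw [hc, mulVec_mulVec, mul_nonsing_inv _ hdet, one_mulVec]
  have hbc : 1 ≤ β ⬝ᵥ c := h.2 b hb c hMc
  have hdet' : (Matrix.fromBlocks M (replicateCol Unit β) (replicateRow Unit β)
      (of fun _ _ : Unit => (2 : ℝ))).det = M.det * (2 - β ⬝ᵥ c) := by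
    let := M.invertibleOfIsUnitDet hdet
    rw [det_fromBlocks₁₁, det_unique (n := Unit), invOf_eq_nonsing_inv, sub_apply, Matrix.mul_assoc]
    congr 2
  have hs : 0 < 2 - β ⬝ᵥ c := by
    have := hM'.det_pos
    rw [hdet'] at this
    exact pos_of_mul_pos_right this hM.det_pos.le
  refine ⟨?_, fun z hz y hy => ?_⟩
  · rw [hdet']
    nlinarith [h.1, hM.det_pos]
  set u : ι → ℝ := fun i => (z (Sum.inl i) : ℝ) with hu
  set m : ℝ := (z (Sum.inr ()) : ℝ) with hm
  set y₁ : ι → ℝ := fun i => y (Sum.inl i) with hy₁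
  set t : ℝ := y (Sum.inr ()) with ht
  have h1 : M *ᵥ y₁ + t • β = u := by
    funext i
    have := congrFun hy (Sum.inl i)
    simpa [fromBlocks_mulVec, mulVec, dotProduct, mul_comm, Function.comp_def] using this
  have h2 : β ⬝ᵥ y₁ + 2 * t = m := by
    have := congrFun hy (Sum.inr ())
    simpa [fromBlocks_mulVec, mulVec, dotProduct, mul_comm, Function.comp_def] using this
  set q : ι → ℝ := M⁻¹ *ᵥ u with hq
  have hMq : M *ᵥ q = u := by rw [hq, mulVec_mulVec, mul_nonsing_inv _ hdet, one_mulVec]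
  have hy₁q : y₁ = q - t • c := by
    have : M⁻¹ *ᵥ (M *ᵥ y₁) = M⁻¹ *ᵥ (u - t • β) := by rw [← h1]; simp
    rwa [mulVec_mulVec, nonsing_inv_mul _ hdet, one_mulVec, mulVec_sub, mulVec_smul] at this
  have huc : u ⬝ᵥ c = β ⬝ᵥ q := by
    rw [← hMq, ← hMc, dotProduct_comm, dotProduct_mulVec, ← mulVec_transpose, hsymm]
  have hsum : ∑ i, (z i : ℝ) * y i = u ⬝ᵥ q + t ^ 2 * (2 - β ⬝ᵥ c) := by
    have hm' : m = β ⬝ᵥ q + t * (2 - β ⬝ᵥ c) := by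
      rw [← h2, hy₁q, dotProduct_sub, dotProduct_smul, smul_eq_mul]; ring
    have : ∑ i, (z i : ℝ) * y i = u ⬝ᵥ y₁ + m * t := by
      simp [Fintype.sum_sum_type, dotProduct, hu, hy₁, hm, ht]
    rw [this, hy₁q, dotProduct_sub, dotProduct_smul, huc, hm', smul_eq_mul]; ring
  rw [hsum]
  by_cases hzu : (fun i => z (Sum.inl i)) = 0
  · have hu0 : u = 0 := by
      funext i
      simpa [hu] using congrFun hzu i
    have hz0 : z (Sum.inr ()) ≠ 0 := fun h0 => hz (by
      funext i
      rcases i with i | ⟨⟩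
      · exact congrFun hzu i
      · exact h0)
    -- When the old part vanishes, the norm is `t ^ 2 * s = m ^ 2 / s` with `m` a nonzero integer
    -- and `s ≤ 1`.
    have hmt : m = t * (2 - β ⬝ᵥ c) := by
      rw [← h2, hy₁q, hq, hu0, mulVec_zero, zero_sub, dotProduct_neg, dotProduct_smul, smul_eq_mul]
      ring
    have hm1 : 1 ≤ m ^ 2 := by
      have : 1 ≤ z (Sum.inr ()) ^ 2 := by
        have := sq_nonneg (z (Sum.inr ()))
        have := pow_ne_zero 2 hz0
        omega
      rw [hm]
      exact_mod_cast this
    rw [hu0, zero_dotProduct, zero_add]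
    rw [hmt] at hm1
    nlinarith [mul_nonneg (sq_nonneg t) hs.le]
  · have := h.2 _ hzu q hMq
    have h3 : (1 : ℝ) ≤ u ⬝ᵥ q := this
    nlinarith [mul_nonneg (sq_nonneg t) hs.le]

/-- This is `D₄` up to signs of the basis. Its dual norm is half a sum of four integer squares, and
that sum is even and vanishes only at `z = 0`. -/
theorem dualMinGeOne_claw :
    DualMinGeOne (!![2, 1, 1, 1; 1, 2, 0, 0; 1, 0, 2, 0; 1, 0, 0, 2] : Matrix _ _ ℝ) := by
  refine ⟨by simp [det_succ_row_zero, Fin.sum_univ_succ, Fin.succAbove]; norm_num,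
    fun z hz y hy => ?_⟩
  have h0 := congrFun hy 0
  have h1 := congrFun hy 1
  have h2 := congrFun hy 2
  have h3 := congrFun hy 3
  simp [mulVec, dotProduct, Fin.sum_univ_four] at h0 h1 h2 h3
  have key : ∑ i, (z i : ℝ) * y i =
      ((2 * z 0 - z 1 - z 2 - z 3 : ℤ) ^ 2 + z 1 ^ 2 + z 2 ^ 2 + z 3 ^ 2 : ℤ) / 2 := by
    push_cast
    rw [Fin.sum_univ_four, ← h0, ← h1, ← h2, ← h3]
    ring
  rw [key]
  have hz' : ¬ (z 0 = 0 ∧ z 1 = 0 ∧ z 2 = 0 ∧ z 3 = 0) := fun h => hz (by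
    funext i; fin_cases i <;> simp [h])
  have : 2 ≤ (2 * z 0 - z 1 - z 2 - z 3 : ℤ) ^ 2 + z 1 ^ 2 + z 2 ^ 2 + z 3 ^ 2 := by
    have heven : (2 * z 0 - z 1 - z 2 - z 3 : ℤ) ^ 2 + z 1 ^ 2 + z 2 ^ 2 + z 3 ^ 2 =
        2 * (2 * z 0 ^ 2 - 2 * z 0 * (z 1 + z 2 + z 3) + z 1 ^ 2 + z 2 ^ 2 + z 3 ^ 2 +
          z 1 * z 2 + z 1 * z 3 + z 2 * z 3) := by ring
    have s0 := sq_nonneg (2 * z 0 - z 1 - z 2 - z 3)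
    have s1 := sq_nonneg (z 1)
    have s2 := sq_nonneg (z 2)
    have s3 := sq_nonneg (z 3)
    by_contra hlt
    have e0 := pow_eq_zero_iff two_ne_zero |>.1
      (show (2 * z 0 - z 1 - z 2 - z 3) ^ 2 = 0 by omega)
    have e1 := pow_eq_zero_iff two_ne_zero |>.1 (show z 1 ^ 2 = 0 by omega)
    have e2 := pow_eq_zero_iff two_ne_zero |>.1 (show z 2 ^ 2 = 0 by omega)
    have e3 := pow_eq_zero_iff two_ne_zero |>.1 (show z 3 ^ 2 = 0 by omega)
    exact hz' (by omega)
  have : (2 : ℝ) ≤ ((2 * z 0 - z 1 - z 2 - z 3 : ℤ) ^ 2 + z 1 ^ 2 + z 2 ^ 2 + z 3 ^ 2 : ℤ) := by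
    exact_mod_cast this
  linarith

/-- Another basis of `D₄`: the dual norm is a quarter of a sum of four squares, which is a multiple
of `4`. -/
theorem dualMinGeOne_diamond :
    DualMinGeOne (!![2, 1, 1, 1; 1, 2, 1, 1; 1, 1, 2, 0; 1, 1, 0, 2] : Matrix _ _ ℝ) := by
  refine ⟨by simp [det_succ_row_zero, Fin.sum_univ_succ, Fin.succAbove]; norm_num,
    fun z hz y hy => ?_⟩
  have h0 := congrFun hy 0
  have h1 := congrFun hy 1
  have h2 := congrFun hy 2
  have h3 := congrFun hy 3
  simp [mulVec, dotProduct, Fin.sum_univ_four] at h0 h1 h2 h3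
  have key : ∑ i, (z i : ℝ) * y i =
      ((z 0 + z 1 - z 3) ^ 2 + (z 0 - z 1 + z 3) ^ 2 + (z 1 + z 3 - z 0) ^ 2 +
        (2 * z 2 - z 0 - z 1 + z 3) ^ 2 : ℤ) / 4 := by
    push_cast
    rw [Fin.sum_univ_four, ← h0, ← h1, ← h2, ← h3]
    ring
  rw [key]
  have hz' : ¬ (z 0 = 0 ∧ z 1 = 0 ∧ z 2 = 0 ∧ z 3 = 0) := fun h => hz (by
    funext i; fin_cases i <;> simp [h])
  have : 4 ≤ (z 0 + z 1 - z 3) ^ 2 + (z 0 - z 1 + z 3) ^ 2 + (z 1 + z 3 - z 0) ^ 2 +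
        (2 * z 2 - z 0 - z 1 + z 3) ^ 2 := by
    have hfour : (z 0 + z 1 - z 3) ^ 2 + (z 0 - z 1 + z 3) ^ 2 + (z 1 + z 3 - z 0) ^ 2 +
        (2 * z 2 - z 0 - z 1 + z 3) ^ 2 =
        4 * (z 0 ^ 2 + z 1 ^ 2 + z 2 ^ 2 + z 3 ^ 2 - z 2 * z 0 - z 2 * z 1 + z 2 * z 3 -
          z 0 * z 3 - z 1 * z 3) := by ring
    have s0 := sq_nonneg (z 0 + z 1 - z 3)
    have s1 := sq_nonneg (z 0 - z 1 + z 3)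
    have s2 := sq_nonneg (z 1 + z 3 - z 0)
    have s3 := sq_nonneg (2 * z 2 - z 0 - z 1 + z 3)
    by_contra hlt
    have e0 := pow_eq_zero_iff two_ne_zero |>.1 (show (z 0 + z 1 - z 3) ^ 2 = 0 by omega)
    have e1 := pow_eq_zero_iff two_ne_zero |>.1 (show (z 0 - z 1 + z 3) ^ 2 = 0 by omega)
    have e2 := pow_eq_zero_iff two_ne_zero |>.1 (show (z 1 + z 3 - z 0) ^ 2 = 0 by omega)
    have e3 := pow_eq_zero_iff two_ne_zero |>.1
      (show (2 * z 2 - z 0 - z 1 + z 3) ^ 2 = 0 by omega)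
    exact hz' (by omega)
  have : (4 : ℝ) ≤ ((z 0 + z 1 - z 3) ^ 2 + (z 0 - z 1 + z 3) ^ 2 + (z 1 + z 3 - z 0) ^ 2 +
        (2 * z 2 - z 0 - z 1 + z 3) ^ 2 : ℤ) := by
    exact_mod_cast this
  linarith

/-- An integral positive definite matrix with diagonal `2` and constant row sums `8` has no principal
submatrix whose lattice has small determinant and dual minimum at least `1`. -/
theorem not_dualMinGeOne_of_rowSum {V : Type*} [Fintype V] [DecidableEq V] {P : Matrix V V ℤ}
    (hP : (P.map (Int.cast : ℤ → ℝ)).PosDef) (hdiag : ∀ v, P v v = 2)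
    (hrow : ∀ v, ∑ w, P v w = 8) {ι : Type} [Fintype ι] [DecidableEq ι] [Nonempty ι]
    (e : ι → V) (he : Function.Injective e) :
    ¬ ((P.map (Int.cast : ℤ → ℝ)).submatrix e e).DualMinGeOne := by
  intro h
  induction hn : Fintype.card V - Fintype.card ι using Nat.strong_induction_on generalizing ι with
  | _ n ih =>
  have hsymm : ∀ v w, P v w = P w v := fun v w => by
    have := hP.isHermitian.apply w v
    simpa using this
  -- Either the chosen indices are orthogonal to all others, or one more index can be adjoined.
  by_cases hclosed : ∀ v, v ∉ Set.range e → ∀ i, P (e i) v = 0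
  · set M : Matrix ι ι ℤ := P.submatrix e e with hM
    have hMmap : (P.map (Int.cast : ℤ → ℝ)).submatrix e e = M.map (Int.cast : ℤ → ℝ) := rfl
    have hdet : ((P.map (Int.cast : ℤ → ℝ)).submatrix e e).det = (M.det : ℝ) := by
      rw [hMmap]
      exact ((Int.castRingHom ℝ).map_det M).symm
    have hpos := (hP.submatrix he).det_pos
    have hle := h.1
    rw [hdet] at hpos hle
    have hpos' : 0 < M.det := by exact_mod_cast hpos
    have hle' : M.det ≤ 4 := by exact_mod_cast hle
    have hone : M *ᵥ 1 = 8 • 1 := by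
      funext i
      have : ∑ j, P (e i) (e j) = 8 := by
        rw [← hrow (e i), ← Finset.sum_image (s := Finset.univ) (g := e)
          (f := fun v => P (e i) v) (fun a _ b _ hab => he hab)]
        refine Finset.sum_subset (Finset.subset_univ _) fun v _ hv => hclosed v ?_ i
        rintro ⟨j, rfl⟩
        exact hv (Finset.mem_image_of_mem e (Finset.mem_univ j))
      simpa [mulVec, dotProduct, hM] using this
    -- Since `M *ᵥ 1 = 8 • 1`, any coordinate of this identity shows that `8` divides `M.det`,
    -- against `0 < M.det ≤ 4`.
    have hadj : M.adjugate *ᵥ (M *ᵥ 1) = M.det • 1 := by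
      rw [mulVec_mulVec, adjugate_mul, smul_mulVec, one_mulVec]
    obtain ⟨i⟩ := ‹Nonempty ι›
    rw [hone, mulVec_smul] at hadj
    have := congrFun hadj i
    simp only [Pi.smul_apply, nsmul_eq_mul, smul_eq_mul, Pi.one_apply] at this
    push_cast at this
    omega
  · push Not at hclosed
    obtain ⟨v, hv, i₀, hi₀⟩ := hclosed
    set e' : ι ⊕ Unit → V := Sum.elim e fun _ => v with he'
    have hinj : Function.Injective e' :=
      Function.Injective.sumElim he (fun _ _ _ => rfl) fun i _ hiv => hv ⟨i, hiv⟩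
    have hcard : Fintype.card (ι ⊕ Unit) ≤ Fintype.card V := Fintype.card_le_of_injective e' hinj
    rw [Fintype.card_sum, Fintype.card_unit] at hcard
    have hblocks : (P.map (Int.cast : ℤ → ℝ)).submatrix e' e' =
        Matrix.fromBlocks ((P.map (Int.cast : ℤ → ℝ)).submatrix e e)
          (replicateCol Unit fun i => ((P (e i) v : ℤ) : ℝ))
          (replicateRow Unit fun i => ((P (e i) v : ℤ) : ℝ)) (of fun _ _ : Unit => (2 : ℝ)) := by
      ext i j
      rcases i with i | i <;> rcases j with j | j <;> simp [he', hsymm v, hdiag]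
    have hpd := hP.submatrix hinj
    refine ih (Fintype.card V - Fintype.card (ι ⊕ Unit)) ?_ e' hinj ?_ rfl
    · rw [Fintype.card_sum, Fintype.card_unit]; omega
    · rw [hblocks] at hpd ⊢
      exact h.fromBlocks (hP.submatrix he) (b := fun i => P (e i) v)
        (fun h0 => hi₀ (congrFun h0 i₀)) hpd

end Matrix

/-! ### The matrix `A ^ 2 - 1`, and why the graph is cubic. -/

namespace SimpleGraph

variable {V : Type*} [Fintype V] [DecidableEq V] (G : SimpleGraph V) [DecidableRel G.Adj]

/-- The integral matrix `A ^ 2 - 1`, where `A` is the adjacency matrix of `G`. -/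
def sqSubOne : Matrix V V ℤ := G.adjMatrix ℤ * G.adjMatrix ℤ - 1

/-- Distinct vertices with a common neighbour. -/
def Linked (u v : V) : Prop := u ≠ v ∧ ∃ w, G.Adj u w ∧ G.Adj v w

variable {G}

omit [Fintype V] [DecidableEq V] [DecidableRel G.Adj] in
theorem Linked.symm {u v : V} (h : G.Linked u v) : G.Linked v u :=
  ⟨h.1.symm, h.2.imp fun _ hw => hw.symm⟩

theorem sqSubOne_self (v : V) : G.sqSubOne v v = G.degree v - 1 := by
  rw [sqSubOne, Matrix.sub_apply, Matrix.one_apply_eq, adjMatrix_mul_self_apply_self]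

theorem sqSubOne_of_ne {u v : V} (h : u ≠ v) :
    G.sqSubOne u v = ((G.neighborFinset u ∩ G.neighborFinset v).card : ℤ) := by
  rw [sqSubOne, Matrix.sub_apply, Matrix.one_apply_ne h, sub_zero, adjMatrix_mul_apply,
    ← Finset.filter_mem_eq_inter, Finset.card_filter, Nat.cast_sum]
  refine Finset.sum_congr rfl fun w _ => ?_
  simp [adjMatrix_apply, G.adj_comm w v]

theorem sqSubOne_rowSum (h : ∀ v, G.degree v = 3) (v : V) : ∑ w, G.sqSubOne v w = 8 := by
  have h1 : ∑ w, (1 : Matrix V V ℤ) v w = 1 := by simp [Matrix.one_apply]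
  have h2 : ∑ w, (G.adjMatrix ℤ * G.adjMatrix ℤ) v w = 9 := by
    simp_rw [adjMatrix_mul_apply]
    rw [Finset.sum_comm]
    have h3 : ∀ u, ∑ w, G.adjMatrix ℤ u w = 3 := fun u => by
      simp_rw [adjMatrix_apply]
      rw [Finset.sum_boole, ← neighborFinset_eq_filter, card_neighborFinset_eq_degree, h u]
      rfl
    rw [Finset.sum_congr rfl fun u _ => h3 u, Finset.sum_const, card_neighborFinset_eq_degree, h v]
    rfl
  simp_rw [sqSubOne, Matrix.sub_apply]
  rw [Finset.sum_sub_distrib, h1, h2]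
  rfl

theorem sqSubOne_quadratic_pos (hP : (G.sqSubOne.map (Int.cast : ℤ → ℝ)).PosDef)
    {k : ℕ} (e : Fin k → V) (he : Function.Injective e)
    (c : Fin k → ℤ) (hc : c ≠ 0) : 0 < ∑ i, ∑ j, c i * G.sqSubOne (e i) (e j) * c j := by
  have := (hP.submatrix he).dotProduct_mulVec_pos (x := fun i => (c i : ℝ))
    (fun h => hc (funext fun i => by simpa using congrFun h i))
  have h2 : (0 : ℝ) < ((∑ i, ∑ j, c i * G.sqSubOne (e i) (e j) * c j : ℤ) : ℝ) := by
    push_cast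
    simpa [dotProduct, Matrix.mulVec, Finset.mul_sum, mul_assoc] using this
  exact_mod_cast h2

theorem sqSubOne_symm (hP : (G.sqSubOne.map (Int.cast : ℤ → ℝ)).PosDef)
    (u v : V) : G.sqSubOne u v = G.sqSubOne v u := by
  have := hP.isHermitian.apply v u
  simpa using this

theorem two_le_degree (hP : (G.sqSubOne.map (Int.cast : ℤ → ℝ)).PosDef)
    (v : V) : 2 ≤ G.degree v := by
  have := hP.diag_pos (i := v)
  rw [Matrix.map_apply, sqSubOne_self] at this
  have h : (0 : ℤ) < G.degree v - 1 := by exact_mod_cast this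
  omega

theorem two_mul_sqSubOne_lt (hP : (G.sqSubOne.map (Int.cast : ℤ → ℝ)).PosDef)
    {u v : V} (h : u ≠ v) :
    2 * G.sqSubOne u v < G.sqSubOne u u + G.sqSubOne v v := by
  have hinj : Function.Injective ![u, v] := by
    intro i j hij
    fin_cases i <;> fin_cases j <;> simp_all
  have := sqSubOne_quadratic_pos hP ![u, v] hinj ![1, -1] (fun h => by simpa using congrFun h 0)
  simp [Fin.sum_univ_two] at this
  have := sqSubOne_symm hP u v
  omega


theorem sqSubOne_mem (hP : (G.sqSubOne.map (Int.cast : ℤ → ℝ)).PosDef)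
    (hdeg : ∀ v, G.degree v ≤ 3) {u v : V} (h : u ≠ v) :
    0 ≤ G.sqSubOne u v ∧ G.sqSubOne u v ≤ 1 := by
  have h1 := two_mul_sqSubOne_lt hP h
  rw [sqSubOne_self, sqSubOne_self] at h1
  have := hdeg u
  have := hdeg v
  refine ⟨?_, by omega⟩
  rw [sqSubOne_of_ne h]
  positivity

/-- Reading adjacency as incidence of points with lines, two points lie on at most one line.
`Linked` then means collinear. -/
theorem eq_of_adj_of_adj (hP : (G.sqSubOne.map (Int.cast : ℤ → ℝ)).PosDef)
    (hdeg : ∀ v, G.degree v ≤ 3) {u v l m : V} (h : u ≠ v) (hul : G.Adj u l) (hvl : G.Adj v l)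
    (hum : G.Adj u m) (hvm : G.Adj v m) : l = m := by
  have h1 := (sqSubOne_mem hP hdeg h).2
  rw [sqSubOne_of_ne h] at h1
  exact Finset.card_le_one.1 (by exact_mod_cast h1) l (by simp [hul, hvl]) m (by simp [hum, hvm])

theorem sqSubOne_of_linked (hP : (G.sqSubOne.map (Int.cast : ℤ → ℝ)).PosDef)
    (hdeg : ∀ v, G.degree v ≤ 3) {u v : V} (h : G.Linked u v) : G.sqSubOne u v = 1 := by
  have h1 := (sqSubOne_mem hP hdeg h.1).2
  obtain ⟨hne, w, hu, hv⟩ := h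
  rw [sqSubOne_of_ne hne] at h1 ⊢
  have : 0 < (G.neighborFinset u ∩ G.neighborFinset v).card :=
    Finset.card_pos.2 ⟨w, by simp [hu, hv]⟩
  omega

theorem sqSubOne_of_not_linked {u v : V} (hne : u ≠ v) (h : ¬ G.Linked u v) :
    G.sqSubOne u v = 0 := by
  rw [sqSubOne_of_ne hne, Nat.cast_eq_zero, Finset.card_eq_zero, Finset.eq_empty_iff_forall_notMem]
  intro w hw
  simp only [Finset.mem_inter, mem_neighborFinset] at hw
  exact h ⟨hne, w, hw⟩

theorem not_linked_of_degree_eq_two (hP : (G.sqSubOne.map (Int.cast : ℤ → ℝ)).PosDef)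
    (hdeg : ∀ v, G.degree v ≤ 3) {u v : V} (hu : G.degree u = 2) (hv : G.degree v = 2) :
    ¬ G.Linked u v := by
  intro h
  have h1 := two_mul_sqSubOne_lt hP h.1
  rw [sqSubOne_of_linked hP hdeg h, sqSubOne_self, sqSubOne_self, hu, hv] at h1
  norm_num at h1

theorem degree_eq_three_of_linked (hP : (G.sqSubOne.map (Int.cast : ℤ → ℝ)).PosDef)
    (hdeg : ∀ v, G.degree v ≤ 3) {u v : V} (hu : G.degree u = 2) (h : G.Linked u v) :
    G.degree v = 3 := by
  have h1 := hdeg v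
  have h2 := two_le_degree hP v
  have h3 : G.degree v ≠ 2 := fun hv => not_linked_of_degree_eq_two hP hdeg hu hv h
  omega

/-- Otherwise the vector `-2p + a + b` would have norm `4 + 2 + 2 - 4 - 4 = 0`. -/
theorem linked_of_degree_eq_two (hP : (G.sqSubOne.map (Int.cast : ℤ → ℝ)).PosDef)
    (hdeg : ∀ v, G.degree v ≤ 3) {p a b : V} (hp : G.degree p = 2) (ha : G.Linked p a)
    (hb : G.Linked p b) (hab : a ≠ b) : G.Linked a b := by
  by_contra h
  have hinj : Function.Injective ![p, a, b] := by
    have := ha.1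
    have := hb.1
    intro i j hij
    fin_cases i <;> fin_cases j <;> simp_all
  have hpos := sqSubOne_quadratic_pos hP ![p, a, b] hinj ![-2, 1, 1]
    (fun h => by simpa using congrFun h 1)
  simp [Fin.sum_univ_three, sqSubOne_self, sqSubOne_of_linked hP hdeg ha,
    sqSubOne_of_linked hP hdeg hb, sqSubOne_of_linked hP hdeg ha.symm,
    sqSubOne_of_linked hP hdeg hb.symm, sqSubOne_of_not_linked hab h,
    sqSubOne_of_not_linked hab.symm (fun h' => h h'.symm), hp,
    degree_eq_three_of_linked hP hdeg hp ha, degree_eq_three_of_linked hP hdeg hp hb] at hpos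

/-- Otherwise the vector `2p - a - b + q` would have norm `deg q - 3 ≤ 0`. -/
theorem linked_of_linked_of_degree_eq_two (hP : (G.sqSubOne.map (Int.cast : ℤ → ℝ)).PosDef)
    (hdeg : ∀ v, G.degree v ≤ 3) {p a b q : V} (hp : G.degree p = 2) (ha : G.Linked p a)
    (hb : G.Linked p b) (hab : a ≠ b) (hqa : G.Linked q a) (hqb : G.Linked q b) (hqp : q ≠ p) :
    G.Linked q p := by
  by_contra h
  have hinj : Function.Injective ![p, a, b, q] := by
    have := ha.1
    have := hb.1
    have := hqa.1
    have := hqb.1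
    intro i j hij
    fin_cases i <;> fin_cases j <;> simp_all
  have hpos := sqSubOne_quadratic_pos hP ![p, a, b, q] hinj ![2, -1, -1, 1]
    (fun h => by simpa using congrFun h 1)
  have hlab := linked_of_degree_eq_two hP hdeg hp ha hb hab
  have hq := hdeg q
  simp [Fin.sum_univ_four, sqSubOne_self, sqSubOne_of_linked hP hdeg ha,
    sqSubOne_of_linked hP hdeg hb, sqSubOne_of_linked hP hdeg ha.symm,
    sqSubOne_of_linked hP hdeg hb.symm, sqSubOne_of_linked hP hdeg hlab,
    sqSubOne_of_linked hP hdeg hlab.symm, sqSubOne_of_linked hP hdeg hqa,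
    sqSubOne_of_linked hP hdeg hqb, sqSubOne_of_linked hP hdeg hqa.symm,
    sqSubOne_of_linked hP hdeg hqb.symm, sqSubOne_of_not_linked hqp h,
    sqSubOne_of_not_linked hqp.symm (fun h' => h h'.symm), hp,
    degree_eq_three_of_linked hP hdeg hp ha, degree_eq_three_of_linked hP hdeg hp hb] at hpos
  omega

theorem exists_adj_of_degree_eq_three {v a b : V} (hv : G.degree v = 3) :
    ∃ c, G.Adj v c ∧ c ≠ a ∧ c ≠ b := by
  by_contra! h
  have hsub : G.neighborFinset v ⊆ {a, b} := fun c hc => by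
    have := h c (by simpa using hc)
    simp only [Finset.mem_insert, Finset.mem_singleton]
    tauto
  have := (Finset.card_le_card hsub).trans Finset.card_le_two
  rw [card_neighborFinset_eq_degree] at this
  omega

theorem exists_adj_ne_of_two_le_degree {v : V} (a : V) (hv : 2 ≤ G.degree v) :
    ∃ c, G.Adj v c ∧ c ≠ a := by
  by_contra! h
  have hsub : G.neighborFinset v ⊆ {a} := fun c hc => by simpa using h c (by simpa using hc)
  have := Finset.card_le_card hsub
  rw [card_neighborFinset_eq_degree, Finset.card_singleton] at this
  omega

/-- The points `a` and `b` are joined by a line `m`. A third point `q` on `m` would be collinear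
with `p`, hence lie on `l₁` or `l₂`, and then meet `a` or `b` on two lines. -/
theorem exists_degree_eq_two_of_degree_eq_two (hP : (G.sqSubOne.map (Int.cast : ℤ → ℝ)).PosDef)
    (hdeg : ∀ v, G.degree v ≤ 3) {p l₁ l₂ a b : V} (hp : G.degree p = 2) (hl : l₁ ≠ l₂)
    (hp₁ : G.Adj p l₁) (hp₂ : G.Adj p l₂) (ha : G.Adj a l₁) (hb : G.Adj b l₂) (hap : a ≠ p)
    (hbp : b ≠ p) : ∃ m, G.Adj a m ∧ G.Adj b m ∧ G.degree m = 2 := by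
  have U : ∀ {u v l m : V}, u ≠ v → G.Adj u l → G.Adj v l → G.Adj u m → G.Adj v m → l = m :=
    fun h h1 h2 h3 h4 => eq_of_adj_of_adj hP hdeg h h1 h2 h3 h4
  have hN : ∀ l, G.Adj p l → l = l₁ ∨ l = l₂ := by
    have hsub : {l₁, l₂} ⊆ G.neighborFinset p := by
      intro x
      simp only [Finset.mem_insert, Finset.mem_singleton, mem_neighborFinset]
      rintro (rfl | rfl) <;> assumption
    have heq := Finset.eq_of_subset_of_card_le hsub (by
      rw [card_neighborFinset_eq_degree, hp, Finset.card_pair hl])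
    intro l h
    rw [← mem_neighborFinset, ← heq] at h
    simpa using h
  have hpa : G.Linked p a := ⟨hap.symm, l₁, hp₁, ha⟩
  have hpb : G.Linked p b := ⟨hbp.symm, l₂, hp₂, hb⟩
  have hab : a ≠ b := by
    rintro rfl
    exact hl (U hap ha hp₁ hb hp₂)
  obtain ⟨-, m, ham, hbm⟩ := linked_of_degree_eq_two hP hdeg hp hpa hpb hab
  refine ⟨m, ham, hbm, ?_⟩
  have hm1 : l₁ ≠ m := by
    rintro rfl
    exact hl (U hbp hbm hp₁ hb hp₂)
  have hm2 : l₂ ≠ m := by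
    rintro rfl
    exact hl (U hap ha hp₁ ham hp₂)
  have h2 := two_le_degree hP m
  have h3 := hdeg m
  by_contra hne
  obtain ⟨q, hq, hqa, hqb⟩ := exists_adj_of_degree_eq_three (a := a) (b := b)
    (show G.degree m = 3 by omega)
  have hqp : q ≠ p := by
    rintro rfl
    rcases hN m hq.symm with h | h
    · exact hm1 h.symm
    · exact hm2 h.symm
  obtain ⟨-, w, hqw, hpw⟩ := linked_of_linked_of_degree_eq_two hP hdeg hp hpa hpb hab
    ⟨hqa, m, hq.symm, ham⟩ ⟨hqb, m, hq.symm, hbm⟩ hqp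
  rcases hN w hpw with rfl | rfl
  · exact hm1 (U hqa hqw ha hq.symm ham)
  · exact hm2 (U hqb hqw hb hq.symm hbm)

/-- Let `p` have degree `2`. If one of its lines has two further points, joining them to a point `a`
of the other line gives two lines of degree `2` through `a`, which are linked. So both lines at `p`
have degree `2`, and they are linked through `p`. Linked vertices of degree `2` are impossible. -/
theorem degree_eq_three_of_posDef (hP : (G.sqSubOne.map (Int.cast : ℤ → ℝ)).PosDef)
    (hdeg : ∀ v, G.degree v ≤ 3) (p : V) : G.degree p = 3 := by
  have hp2 := two_le_degree hP p
  have hp3 := hdeg p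
  by_contra hp
  replace hp : G.degree p = 2 := by omega
  obtain ⟨l, hl⟩ := exists_adj_ne_of_two_le_degree p hp2
  obtain ⟨l', hl'⟩ := exists_adj_ne_of_two_le_degree l hp2
  have key : ∀ l₁ l₂, G.Adj p l₁ → G.Adj p l₂ → l₁ ≠ l₂ → G.degree l₂ ≠ 3 := by
    intro l₁ l₂ h₁ h₂ hne hd
    obtain ⟨a, ha, hap⟩ := exists_adj_ne_of_two_le_degree p (two_le_degree hP l₁)
    obtain ⟨b, hb, hbp, -⟩ := exists_adj_of_degree_eq_three (a := p) (b := p) hd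
    obtain ⟨b', hb', hbp', hbb⟩ := exists_adj_of_degree_eq_three (a := p) (b := b) hd
    obtain ⟨m, ham, hbm, hm⟩ := exists_degree_eq_two_of_degree_eq_two hP hdeg hp hne h₁ h₂
      ha.symm hb.symm hap hbp
    obtain ⟨m', ham', hbm', hm'⟩ := exists_degree_eq_two_of_degree_eq_two hP hdeg hp hne h₁ h₂
      ha.symm hb'.symm hap hbp'
    refine not_linked_of_degree_eq_two hP hdeg hm hm' ⟨?_, a, ham.symm, ham'.symm⟩
    rintro rfl
    have := eq_of_adj_of_adj hP hdeg hbb hbm' hbm hb'.symm hb.symm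
    rw [this] at hm
    omega
  have h1 := key l l' hl.1 hl'.1 hl'.2.symm
  have h2 := key l' l hl'.1 hl.1 hl'.2
  have h3 := hdeg l
  have h4 := hdeg l'
  have h5 := two_le_degree hP l
  have h6 := two_le_degree hP l'
  exact not_linked_of_degree_eq_two hP hdeg (show G.degree l = 2 by omega)
    (show G.degree l' = 2 by omega) ⟨hl'.2.symm, p, hl.1.symm, hl'.1.symm⟩

end SimpleGraph

/-! ### Excluding claws and diamonds: collinearity is transitive. -/

namespace SimpleGraph

variable {V : Type*} [Fintype V] [DecidableEq V] {G : SimpleGraph V} [DecidableRel G.Adj]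

theorem not_linked_claw (hP : (G.sqSubOne.map (Int.cast : ℤ → ℝ)).PosDef)
    (hdeg : ∀ v, G.degree v = 3) {p a b c : V} (ha : G.Linked p a) (hb : G.Linked p b)
    (hc : G.Linked p c) (hab : a ≠ b) (hac : a ≠ c) (hbc : b ≠ c) :
    G.Linked a b ∨ G.Linked a c ∨ G.Linked b c := by
  by_contra! h
  have hdeg' : ∀ v, G.degree v ≤ 3 := fun v => (hdeg v).le
  have hinj : Function.Injective ![p, a, b, c] := by
    have := ha.1
    have := hb.1
    have := hc.1
    intro i j hij
    fin_cases i <;> fin_cases j <;> simp_all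
  refine Matrix.not_dualMinGeOne_of_rowSum hP (fun v => by rw [sqSubOne_self, hdeg]; rfl)
    (sqSubOne_rowSum hdeg) ![p, a, b, c] hinj ?_
  convert Matrix.dualMinGeOne_claw using 1
  ext i j
  fin_cases i <;> fin_cases j <;>
  simp [sqSubOne_self, hdeg, sqSubOne_of_linked hP hdeg' ha, sqSubOne_of_linked hP hdeg' hb,
    sqSubOne_of_linked hP hdeg' hc, sqSubOne_of_linked hP hdeg' ha.symm,
    sqSubOne_of_linked hP hdeg' hb.symm, sqSubOne_of_linked hP hdeg' hc.symm,
    sqSubOne_of_not_linked hab h.1, sqSubOne_of_not_linked hac h.2.1,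
    sqSubOne_of_not_linked hbc h.2.2, sqSubOne_of_not_linked hab.symm fun h' => h.1 h'.symm,
    sqSubOne_of_not_linked hac.symm fun h' => h.2.1 h'.symm,
    sqSubOne_of_not_linked hbc.symm fun h' => h.2.2 h'.symm]

theorem linked_of_diamond (hP : (G.sqSubOne.map (Int.cast : ℤ → ℝ)).PosDef)
    (hdeg : ∀ v, G.degree v = 3) {a b c d : V} (hab : G.Linked a b) (hac : G.Linked a c)
    (had : G.Linked a d) (hbc : G.Linked b c) (hbd : G.Linked b d) (hcd : c ≠ d) :
    G.Linked c d := by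
  by_contra h
  have hdeg' : ∀ v, G.degree v ≤ 3 := fun v => (hdeg v).le
  have hinj : Function.Injective ![a, b, c, d] := by
    have := hab.1
    have := hac.1
    have := had.1
    have := hbc.1
    have := hbd.1
    intro i j hij
    fin_cases i <;> fin_cases j <;> simp_all
  refine Matrix.not_dualMinGeOne_of_rowSum hP (fun v => by rw [sqSubOne_self, hdeg]; rfl)
    (sqSubOne_rowSum hdeg) ![a, b, c, d] hinj ?_
  convert Matrix.dualMinGeOne_diamond using 1
  ext i j
  fin_cases i <;> fin_cases j <;>
  simp [sqSubOne_self, hdeg, sqSubOne_of_linked hP hdeg' hab, sqSubOne_of_linked hP hdeg' hac,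
    sqSubOne_of_linked hP hdeg' had, sqSubOne_of_linked hP hdeg' hbc,
    sqSubOne_of_linked hP hdeg' hbd, sqSubOne_of_linked hP hdeg' hab.symm,
    sqSubOne_of_linked hP hdeg' hac.symm, sqSubOne_of_linked hP hdeg' had.symm,
    sqSubOne_of_linked hP hdeg' hbc.symm, sqSubOne_of_linked hP hdeg' hbd.symm,
    sqSubOne_of_not_linked hcd h, sqSubOne_of_not_linked hcd.symm fun h' => h h'.symm]

/-- In a cubic graph, three distinct neighbours exhaust the neighbourhood. -/
theorem eq_or_eq_or_eq_of_adj {v a b c w : V} (hv : G.degree v = 3) (ha : G.Adj v a)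
    (hb : G.Adj v b) (hc : G.Adj v c) (hab : a ≠ b) (hac : a ≠ c) (hbc : b ≠ c)
    (hw : G.Adj v w) : w = a ∨ w = b ∨ w = c := by
  have hsub : {a, b, c} ⊆ G.neighborFinset v := by
    intro x
    simp only [Finset.mem_insert, Finset.mem_singleton, mem_neighborFinset]
    rintro (rfl | rfl | rfl) <;> assumption
  have heq := Finset.eq_of_subset_of_card_le hsub (by
    rw [card_neighborFinset_eq_degree, hv, Finset.card_eq_three.2 ⟨a, b, c, hab, hac, hbc, rfl⟩])
  rw [← mem_neighborFinset, ← heq] at hw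
  simpa using hw

/-- If points on two of the three lines through `p` are collinear, then their line meets the third
line through `p`. -/
theorem exists_adj_third (hP : (G.sqSubOne.map (Int.cast : ℤ → ℝ)).PosDef)
    (hdeg : ∀ v, G.degree v = 3) {p l₁ l₂ l₃ a c : V} (h₁ : G.Adj p l₁) (h₂ : G.Adj p l₂)
    (h₃ : G.Adj p l₃) (h₁₂ : l₁ ≠ l₂) (h₁₃ : l₁ ≠ l₃) (h₂₃ : l₂ ≠ l₃) (ha : G.Adj a l₁)
    (hap : a ≠ p) (hc : G.Adj c l₂) (hcp : c ≠ p) (hac : G.Linked a c) :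
    ∃ m q, G.Adj a m ∧ G.Adj c m ∧ G.Adj q m ∧ G.Adj q l₃ ∧ q ≠ p := by
  have hdeg' : ∀ v, G.degree v ≤ 3 := fun v => (hdeg v).le
  have U : ∀ {u v l m : V}, u ≠ v → G.Adj u l → G.Adj v l → G.Adj u m → G.Adj v m → l = m :=
    fun h h1 h2 h3 h4 => eq_of_adj_of_adj hP hdeg' h h1 h2 h3 h4
  obtain ⟨hne, m, ham, hcm⟩ := hac
  have hm1 : l₁ ≠ m := by
    rintro rfl
    exact h₁₂ (U hcp hcm h₁ hc h₂)
  have hm2 : l₂ ≠ m := by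
    rintro rfl
    exact h₁₂ (U hap ha h₁ ham h₂)
  obtain ⟨q, hq, hqa, hqc⟩ := exists_adj_of_degree_eq_three (a := a) (b := c) (hdeg m)
  have hqp : q ≠ p := by
    rintro rfl
    exact hm1 (U hap ha h₁ ham hq.symm)
  -- Both `p` and `q` are collinear with each of `a` and `c`, so the excluded diamond makes `p` and
  -- `q` collinear; only `l₃` can join them.
  obtain ⟨-, w, hpw, hqw⟩ := linked_of_diamond hP hdeg ⟨hne, m, ham, hcm⟩ ⟨hap, l₁, ha, h₁⟩
    ⟨hqa.symm, m, ham, hq.symm⟩ ⟨hcp, l₂, hc, h₂⟩ ⟨hqc.symm, m, hcm, hq.symm⟩ hqp.symm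
  refine ⟨m, q, ham, hcm, hq.symm, ?_, hqp⟩
  rcases eq_or_eq_or_eq_of_adj (hdeg p) h₁ h₂ h₃ h₁₂ h₁₃ h₂₃ hpw with rfl | rfl | rfl
  · exact absurd (U hqa hqw ha hq.symm ham) hm1
  · exact absurd (U hqc hqw hc hq.symm hcm) hm2
  · exact hqw

/-- The line `ac` meets `l₃` in some `q`. If `q ≠ b`, then `a` and `b` are both collinear with `p`
and with `q`, which closes a diamond. -/
theorem linked_of_linked_of_third (hP : (G.sqSubOne.map (Int.cast : ℤ → ℝ)).PosDef)
    (hdeg : ∀ v, G.degree v = 3) {p l₁ l₂ l₃ a b c : V} (h₁ : G.Adj p l₁) (h₂ : G.Adj p l₂)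
    (h₃ : G.Adj p l₃) (h₁₂ : l₁ ≠ l₂) (h₁₃ : l₁ ≠ l₃) (h₂₃ : l₂ ≠ l₃) (ha : G.Adj a l₁)
    (hap : a ≠ p) (hc : G.Adj c l₂) (hcp : c ≠ p) (hb : G.Adj b l₃) (hbp : b ≠ p)
    (hac : G.Linked a c) : G.Linked a b := by
  have hdeg' : ∀ v, G.degree v ≤ 3 := fun v => (hdeg v).le
  obtain ⟨m, q, ham, hcm, hqm, hq₃, hqp⟩ :=
    exists_adj_third hP hdeg h₁ h₂ h₃ h₁₂ h₁₃ h₂₃ ha hap hc hcp hac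
  have hne : ∀ {x}, G.Adj x l₃ → x ≠ p → a ≠ x := by
    rintro x hx hxp rfl
    exact h₁₃ (eq_of_adj_of_adj hP hdeg' hap ha h₁ hx h₃)
  have hqa : G.Linked q a := ⟨(hne hq₃ hqp).symm, m, hqm, ham⟩
  by_cases hqb : q = b
  · exact hqb ▸ hqa.symm
  · exact linked_of_diamond hP hdeg (a := p) (b := q) ⟨hqp.symm, l₃, h₃, hq₃⟩
      ⟨hap.symm, l₁, h₁, ha⟩ ⟨hbp.symm, l₃, h₃, hb⟩ hqa ⟨hqb, l₃, hq₃, hb⟩ (hne hb hbp)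

/-- If `a` and `b` were not collinear, a point `c ≠ p` on the third line through `p` would be
collinear with neither, and `p` would be the centre of a claw. -/
theorem Linked.trans (hP : (G.sqSubOne.map (Int.cast : ℤ → ℝ)).PosDef)
    (hdeg : ∀ v, G.degree v = 3) {a p b : V} (ha : G.Linked a p) (hb : G.Linked p b)
    (hab : a ≠ b) : G.Linked a b := by
  by_contra h
  obtain ⟨hap, l₁, ha₁, hp₁⟩ := ha
  obtain ⟨hbp, l₃, hp₃, hb₃⟩ := hb
  have h₁₃ : l₁ ≠ l₃ := by
    rintro rfl
    exact h ⟨hab, l₁, ha₁, hb₃⟩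
  obtain ⟨l₂, hp₂, h₂₁, h₂₃⟩ := exists_adj_of_degree_eq_three (a := l₁) (b := l₃) (hdeg p)
  obtain ⟨c, hc, hcp, -⟩ := exists_adj_of_degree_eq_three (a := p) (b := p) (hdeg l₂)
  have hdeg' : ∀ v, G.degree v ≤ 3 := fun v => (hdeg v).le
  have hac : a ≠ c := by
    rintro rfl
    exact h₂₁ (eq_of_adj_of_adj hP hdeg' hap hc.symm hp₂ ha₁ hp₁)
  have hbc : b ≠ c := by
    rintro rfl
    exact h₂₃ (eq_of_adj_of_adj hP hdeg' hbp hp₂ hc.symm hp₃ hb₃)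
  have hac' : ¬ G.Linked a c := fun h' => h (linked_of_linked_of_third hP hdeg hp₁ hp₂ hp₃ h₂₁.symm
    h₁₃ h₂₃ ha₁ hap hc.symm hcp hb₃ hbp.symm h')
  have hbc' : ¬ G.Linked b c := fun h' => h (linked_of_linked_of_third hP hdeg hp₃ hp₂ hp₁
    h₂₃.symm h₁₃.symm h₂₁ hb₃ hbp.symm hc.symm hcp ha₁ hap h').symm
  rcases not_linked_claw hP hdeg ⟨hap.symm, l₁, hp₁, ha₁⟩ ⟨hbp, l₃, hp₃, hb₃⟩
    ⟨hcp.symm, l₂, hp₂, hc.symm⟩ hab hac hbc with h' | h' | h'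
  · exact h h'
  · exact hac' h'
  · exact hbc' h'

end SimpleGraph

/-! ### Recognising the Heawood graph. -/

namespace SimpleGraph

section Labelling

variable {V : Type*} {G : SimpleGraph V}

theorem adjacency_of_labelling {f g : ZMod 7 → V}
    (h : ∀ j, G.Adj (f j) (g j) ∧ G.Adj (f (j + 1)) (g j) ∧ G.Adj (f (j + 3)) (g j))
    {i j : ZMod 7} (hij : i = j ∨ i = j + 1 ∨ i = j + 3) : G.Adj (f i) (g j) := by
  rcases hij with rfl | rfl | rfl
  · exact (h _).1
  · exact (h _).2.1
  · exact (h _).2.2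

variable [Fintype V] [DecidableEq V] [DecidableRel G.Adj]

/-- A labelled copy of the Heawood graph in a cubic bipartite graph is a connected component. -/
theorem nonempty_iso_heawoodGraph_of_labelling (hbip : G.IsBipartite) (hdeg : ∀ v, G.degree v = 3)
    {f g : ZMod 7 → V} (hf : Function.Injective f)
    (h : ∀ j, G.Adj (f j) (g j) ∧ G.Adj (f (j + 1)) (g j) ∧ G.Adj (f (j + 3)) (g j))
    (C : G.ConnectedComponent) (hC : f 1 ∈ C.supp) :
    Nonempty (C.toSimpleGraph ≃g heawoodGraph) := by
  have hadj : ∀ {i j : ZMod 7}, (i = j ∨ i = j + 1 ∨ i = j + 3) → G.Adj (f i) (g j) :=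
    fun hij => adjacency_of_labelling h hij
  have hgN : ∀ {j w}, G.Adj (g j) w → w = f j ∨ w = f (j + 1) ∨ w = f (j + 3) := by
    intro j w hw
    refine eq_or_eq_or_eq_of_adj (hdeg (g j)) (h j).1.symm (h j).2.1.symm (h j).2.2.symm
      (hf.ne ?_) (hf.ne ?_) (hf.ne ?_) hw
    all_goals clear hw; revert j; decide
  have hiff : ∀ {i j}, G.Adj (f i) (g j) ↔ (i = j ∨ i = j + 1 ∨ i = j + 3) := by
    refine fun {i j} => ⟨fun hij => ?_, hadj⟩
    simpa only [hf.eq_iff] using hgN hij.symm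
  -- Lines of the cyclic model are determined by their points, which makes `g` injective.
  have hline : ∀ j k : ZMod 7, (∀ i, (i = j ∨ i = j + 1 ∨ i = j + 3) ↔
      (i = k ∨ i = k + 1 ∨ i = k + 3)) → j = k := by decide
  have hg : Function.Injective g := fun j k hjk =>
    hline j k fun i => by rw [← hiff, ← hiff, hjk]
  have hfN : ∀ {i w}, G.Adj (f i) w → w = g i ∨ w = g (i - 1) ∨ w = g (i - 3) := by
    intro i w hw
    refine eq_or_eq_or_eq_of_adj (hdeg (f i)) (hadj (Or.inl rfl)) (hadj (Or.inr (Or.inl ?_)))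
      (hadj (Or.inr (Or.inr ?_))) (hg.ne ?_) (hg.ne ?_) (hg.ne ?_) hw
    all_goals clear hw; revert i; decide
  obtain ⟨c⟩ := hbip
  -- Any two points share a line and any two lines share a point, so each class is monochromatic and
  -- no edge joins two points or two lines.
  have hpts : ∀ i k : ZMod 7, ∃ j, (i = j ∨ i = j + 1 ∨ i = j + 3) ∧
      (k = j ∨ k = j + 1 ∨ k = j + 3) := by decide
  have hlines : ∀ j k : ZMod 7, ∃ i, (i = j ∨ i = j + 1 ∨ i = j + 3) ∧
      (i = k ∨ i = k + 1 ∨ i = k + 3) := by decide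
  have hcf : ∀ i k, c (f i) = c (f k) := by
    intro i k
    obtain ⟨j, h1, h2⟩ := hpts i k
    have e1 : c (f i) ≠ c (g j) := c.valid (hadj h1)
    have e2 : c (f k) ≠ c (g j) := c.valid (hadj h2)
    omega
  have hcg : ∀ j k, c (g j) = c (g k) := by
    intro j k
    obtain ⟨i, h1, h2⟩ := hlines j k
    have e1 : c (f i) ≠ c (g j) := c.valid (hadj h1)
    have e2 : c (f i) ≠ c (g k) := c.valid (hadj h2)
    omega
  have hff : ∀ i k, ¬ G.Adj (f i) (f k) := fun i k hik => c.valid hik (hcf i k)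
  have hgg : ∀ i k, ¬ G.Adj (g i) (g k) := fun i k hik => c.valid hik (hcg i k)
  have hfg : ∀ i j, f i ≠ g j := fun i j hij => hff i i (by
    have := (h i).1
    have h1 : c (f i) ≠ c (g i) := c.valid this
    exact absurd (hij ▸ hcg j i) h1)
  have hfC : ∀ i, f i ∈ C.supp := by
    intro i
    obtain ⟨j, h1, h2⟩ := hpts i 1
    rw [ConnectedComponent.mem_supp_iff] at hC ⊢
    rw [← hC]
    exact ConnectedComponent.sound ((hadj h1).reachable.trans (hadj h2).symm.reachable)
  have hgC : ∀ j, g j ∈ C.supp := fun j => by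
    have := hfC j
    rw [ConnectedComponent.mem_supp_iff] at this ⊢
    rw [← this]
    exact ConnectedComponent.sound (h j).1.symm.reachable
  set φ : ZMod 7 ⊕ ZMod 7 → C.supp := Sum.elim (fun i => ⟨f i, hfC i⟩) fun j => ⟨g j, hgC j⟩ with hφ
  have hinj : Function.Injective φ := by
    refine Function.Injective.sumElim (fun a b hab => hf (congrArg Subtype.val hab))
      (fun a b hab => hg (congrArg Subtype.val hab)) fun a b hab => hfg a b (congrArg Subtype.val hab)
  -- The labelled vertices already have all three neighbours labelled, so no walk leaves them.
  have hwalk : ∀ {u v : V}, G.Walk u v → (u ∈ Set.range f ∪ Set.range g) →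
      v ∈ Set.range f ∪ Set.range g := by
    intro u v p
    induction p with
    | nil => exact id
    | cons huw _ ih =>
      intro hu
      refine ih ?_
      rcases hu with ⟨i, rfl⟩ | ⟨j, rfl⟩
      · rcases hfN huw with rfl | rfl | rfl <;> exact Or.inr ⟨_, rfl⟩
      · rcases hgN huw with rfl | rfl | rfl <;> exact Or.inl ⟨_, rfl⟩
  have hsurj : Function.Surjective φ := by
    rintro ⟨v, hv⟩
    have hreach : G.Reachable (f 1) v := by
      rw [ConnectedComponent.mem_supp_iff] at hC hv
      exact ConnectedComponent.exact (hC.trans hv.symm)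
    obtain ⟨p⟩ := hreach
    rcases hwalk p (Or.inl ⟨1, rfl⟩) with ⟨i, rfl⟩ | ⟨j, rfl⟩
    · exact ⟨Sum.inl i, rfl⟩
    · exact ⟨Sum.inr j, rfl⟩
  refine ⟨RelIso.symm ⟨Equiv.ofBijective φ ⟨hinj, hsurj⟩, ?_⟩⟩
  rintro (i | i) (j | j)
  · exact iff_of_false (hff i j) id
  · exact hiff
  · exact (G.adj_comm _ _).trans hiff
  · exact iff_of_false (hgg i j) id

end Labelling

variable {V : Type*} [Fintype V] [DecidableEq V] {G : SimpleGraph V} [DecidableRel G.Adj]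

/-- In the cyclic model the lines through point `1` have indices `0`, `1` and `5`. Points `0, 3` on
line `0` and `2, 4` on line `1` are named freely; each of the four lines joining such pairs meets
line `5` in a point other than `p`. -/
theorem exists_labelling (hP : (G.sqSubOne.map (Int.cast : ℤ → ℝ)).PosDef)
    (hdeg : ∀ v, G.degree v = 3) (p : V) : ∃ f g : ZMod 7 → V, Function.Injective f ∧ f 1 = p ∧
      ∀ j, G.Adj (f j) (g j) ∧ G.Adj (f (j + 1)) (g j) ∧ G.Adj (f (j + 3)) (g j) := by
  have hdeg' : ∀ v, G.degree v ≤ 3 := fun v => (hdeg v).le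
  have U : ∀ {u v l m : V}, u ≠ v → G.Adj u l → G.Adj v l → G.Adj u m → G.Adj v m → l = m :=
    fun h h1 h2 h3 h4 => eq_of_adj_of_adj hP hdeg' h h1 h2 h3 h4
  obtain ⟨g₀, h₁₀, -⟩ := exists_adj_of_degree_eq_three (a := p) (b := p) (hdeg p)
  obtain ⟨g₁, h₁₁, hg₁₀, -⟩ := exists_adj_of_degree_eq_three (a := g₀) (b := g₀) (hdeg p)
  obtain ⟨g₅, h₁₅, hg₅₀, hg₅₁⟩ := exists_adj_of_degree_eq_three (a := g₀) (b := g₁) (hdeg p)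
  obtain ⟨x₀, h₀₀, n₀₁, -⟩ := exists_adj_of_degree_eq_three (a := p) (b := p) (hdeg g₀)
  obtain ⟨x₃, h₃₀, n₃₁, n₃₀⟩ := exists_adj_of_degree_eq_three (a := p) (b := x₀) (hdeg g₀)
  obtain ⟨x₂, h₂₁, n₂₁, -⟩ := exists_adj_of_degree_eq_three (a := p) (b := p) (hdeg g₁)
  obtain ⟨x₄, h₄₁, n₄₁, n₄₂⟩ := exists_adj_of_degree_eq_three (a := p) (b := x₂) (hdeg g₁)
  have hne : ∀ {l m x y}, l ≠ m → G.Adj p l → G.Adj p m → G.Adj l x → G.Adj m y → x ≠ p →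
      x ≠ y := by
    rintro l m x _ hlm hl hm hx hy hxp rfl
    exact hlm (U hxp hx.symm hl hy.symm hm)
  have third : ∀ {x y}, G.Adj g₀ x → G.Adj g₁ y → x ≠ p → y ≠ p →
      ∃ m q, G.Adj x m ∧ G.Adj y m ∧ G.Adj q m ∧ G.Adj q g₅ ∧ q ≠ p := fun hx hy hxp hyp =>
    exists_adj_third hP hdeg h₁₀ h₁₁ h₁₅ hg₁₀.symm hg₅₀.symm hg₅₁.symm hx.symm hxp hy.symm hyp
      (Linked.trans hP hdeg ⟨hxp, g₀, hx.symm, h₁₀⟩ ⟨hyp.symm, g₁, h₁₁, hy.symm⟩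
        (hne hg₁₀.symm h₁₀ h₁₁ hx hy hxp))
  -- The third point of the line through `3` and `2` is named `5`. This is the last choice: `hx` and
  -- `hy` force the third points of the other three joining lines.
  obtain ⟨g₂, x₅, h₃₂, h₂₂, h₅₂, h₅₅, n₅₁⟩ := third h₃₀ h₂₁ n₃₁ n₂₁
  obtain ⟨x₆, h₆₅, n₆₁, n₆₅⟩ := exists_adj_of_degree_eq_three (a := p) (b := x₅) (hdeg g₅)
  have h5 : ∀ {q}, G.Adj q g₅ → q ≠ p → q = x₅ ∨ q = x₆ := fun hq hqp =>
    (eq_or_eq_or_eq_of_adj (hdeg g₅) h₁₅.symm h₅₅.symm h₆₅ n₅₁.symm n₆₁.symm n₆₅.symm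
      hq.symm).resolve_left hqp
  -- a line through `x` on `g₀`, `y` on `g₁` and `q` on `g₅` is determined by `x, q` or by `y, q`
  have hx : ∀ {x y y' q m m'}, G.Adj g₀ x → x ≠ p → G.Adj g₁ y → y ≠ p → G.Adj g₁ y' → y ≠ y' →
      G.Adj q g₅ → G.Adj x m → G.Adj y m → G.Adj q m → G.Adj x m' → G.Adj y' m' →
      ¬ G.Adj q m' := by
    intro x y y' q m m' hx0 hxp hy1 hyp hy1' hyy hq hxm hym hqm hxm' hym' hqm'
    have hmm := U (hne hg₅₀.symm h₁₀ h₁₅ hx0 hq.symm hxp) hxm hqm hxm' hqm'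
    subst hmm
    have := U hyy hym hym' hy1.symm hy1'.symm
    subst this
    exact hg₁₀ (U hxp hxm h₁₁ hx0.symm h₁₀)
  have hy : ∀ {x x' y q m m'}, G.Adj g₀ x → x ≠ p → G.Adj g₀ x' → x ≠ x' → G.Adj g₁ y → y ≠ p →
      G.Adj q g₅ → G.Adj x m → G.Adj y m → G.Adj q m → G.Adj x' m' → G.Adj y m' →
      ¬ G.Adj q m' := by
    intro x x' y q m m' hx0 hxp hx0' hxx hy1 hyp hq hxm hym hqm hxm' hym' hqm'
    have hmm := U (hne hg₅₁.symm h₁₁ h₁₅ hy1 hq.symm hyp) hym hqm hym' hqm'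
    subst hmm
    have := U hxx hxm hxm' hx0.symm hx0'.symm
    subst this
    exact hg₁₀ (U hyp hy1.symm h₁₁ hym h₁₀)
  obtain ⟨g₆, z, h₀₆, h₂₆, hz₆, hz, nz⟩ := third h₀₀ h₂₁ n₀₁ n₂₁
  obtain rfl : z = x₆ := (h5 hz nz).resolve_left fun h =>
    hy h₃₀ n₃₁ h₀₀ n₃₀ h₂₁ n₂₁ h₅₅ h₃₂ h₂₂ h₅₂ h₀₆ h₂₆ (h ▸ hz₆)
  obtain ⟨g₄, w, h₀₄, h₄₄, hw₄, hw, nw⟩ := third h₀₀ h₄₁ n₀₁ n₄₁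
  obtain rfl : w = x₅ := (h5 hw nw).resolve_right fun h =>
    hx h₀₀ n₀₁ h₂₁ n₂₁ h₄₁ n₄₂.symm hz h₀₆ h₂₆ hz₆ h₀₄ h₄₄ (h ▸ hw₄)
  obtain ⟨g₃, v, h₃₃, h₄₃, hv₃, hv, nv⟩ := third h₃₀ h₄₁ n₃₁ n₄₁
  obtain rfl : v = z := (h5 hv nv).resolve_left fun h =>
    hx h₃₀ n₃₁ h₂₁ n₂₁ h₄₁ n₄₂.symm h₅₅ h₃₂ h₂₂ h₅₂ h₃₃ h₄₃ (h ▸ hv₃)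
  have n02 := hne hg₁₀.symm h₁₀ h₁₁ h₀₀ h₂₁ n₀₁
  have n04 := hne hg₁₀.symm h₁₀ h₁₁ h₀₀ h₄₁ n₀₁
  have n05 := hne hg₅₀.symm h₁₀ h₁₅ h₀₀ hw.symm n₀₁
  have n06 := hne hg₅₀.symm h₁₀ h₁₅ h₀₀ hv.symm n₀₁
  have n32 := hne hg₁₀.symm h₁₀ h₁₁ h₃₀ h₂₁ n₃₁
  have n34 := hne hg₁₀.symm h₁₀ h₁₁ h₃₀ h₄₁ n₃₁
  have n35 := hne hg₅₀.symm h₁₀ h₁₅ h₃₀ hw.symm n₃₁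
  have n36 := hne hg₅₀.symm h₁₀ h₁₅ h₃₀ hv.symm n₃₁
  have n25 := hne hg₅₁.symm h₁₁ h₁₅ h₂₁ hw.symm n₂₁
  have n26 := hne hg₅₁.symm h₁₁ h₁₅ h₂₁ hv.symm n₂₁
  have n45 := hne hg₅₁.symm h₁₁ h₁₅ h₄₁ hw.symm n₄₁
  have n46 := hne hg₅₁.symm h₁₁ h₁₅ h₄₁ hv.symm n₄₁
  refine ⟨(![x₀, p, x₂, x₃, x₄, w, v] : Fin 7 → V), (![g₀, g₁, g₂, g₃, g₄, g₅, g₆] : Fin 7 → V),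
    ?_, rfl, ?_⟩
  · refine (List.nodup_ofFn (n := 7)).1 ?_
    change [x₀, p, x₂, x₃, x₄, w, v].Nodup
    simp only [List.nodup_cons, List.mem_cons, List.not_mem_nil, or_false, not_or,
      List.nodup_nil, not_false_iff, and_true]
    exact ⟨⟨n₀₁, n02, n₃₀.symm, n04, n05, n06⟩,
      ⟨n₂₁.symm, n₃₁.symm, n₄₁.symm, n₅₁.symm, n₆₁.symm⟩,
      ⟨n32.symm, n₄₂.symm, n25, n26⟩, ⟨n34, n35, n36⟩, ⟨n45, n46⟩, n₆₅.symm⟩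
  · intro j
    change Fin 7 at j
    fin_cases j
    · exact ⟨h₀₀.symm, h₁₀, h₃₀.symm⟩
    · exact ⟨h₁₁, h₂₁.symm, h₄₁.symm⟩
    · exact ⟨h₂₂, h₃₂, h₅₂⟩
    · exact ⟨h₃₃, h₄₃, hv₃⟩
    · exact ⟨h₄₄, hw₄, h₀₄⟩
    · exact ⟨hw, hv, h₁₅⟩
    · exact ⟨hz₆, h₀₆, h₂₆⟩

theorem nonempty_iso_heawoodGraph_of_posDef (hbip : G.IsBipartite) (hdeg : ∀ v, G.degree v ≤ 3)
    (hP : (G.sqSubOne.map (Int.cast : ℤ → ℝ)).PosDef) (C : G.ConnectedComponent) :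
    Nonempty (C.toSimpleGraph ≃g heawoodGraph) := by
  have hdeg' := degree_eq_three_of_posDef hP hdeg
  obtain ⟨p, hp⟩ := C.nonempty_supp
  obtain ⟨f, g, hf, rfl, h⟩ := exists_labelling hP hdeg' p
  exact nonempty_iso_heawoodGraph_of_labelling hbip hdeg' hf h C hp

end SimpleGraph

/-! ### The spectrum of the Heawood graph. -/

namespace SimpleGraph

variable {V : Type*} [Fintype V] [DecidableEq V] {G : SimpleGraph V} [DecidableRel G.Adj]

/-- The eigenvalue equations of the Heawood graph force the eigenvalue to be `±3` or `±√2`. -/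
theorem sq_eq_of_heawood_equations {a b : ZMod 7 → ℝ} {μ : ℝ}
    (ha : ∀ i, μ * a i = b i + b (i - 1) + b (i - 3))
    (hb : ∀ j, μ * b j = a j + a (j + 1) + a (j + 3)) (h : ¬ (a = 0 ∧ b = 0)) :
    μ ^ 2 = 2 ∨ μ ^ 2 = 9 := by
  by_contra! hμ
  -- The Fano incidence matrix `N` satisfies `N Nᵀ = Nᵀ N = 2I + J`. Summing coordinates gives `(μ ^
  -- 2 - 9) * ∑ u = 0`, after which `(μ ^ 2 - 2) * u = 0`.
  have key : ∀ (u : ZMod 7 → ℝ), (∀ i, μ ^ 2 * u i = 2 * u i + ∑ k, u k) → u = 0 := by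
    intro u hu
    have hsum : (μ ^ 2 - 9) * ∑ k, u k = 0 := by
      have : ∑ i, μ ^ 2 * u i = ∑ i, (2 * u i + ∑ k, u k) := Finset.sum_congr rfl fun i _ => hu i
      rw [← Finset.mul_sum, Finset.sum_add_distrib, ← Finset.mul_sum, Finset.sum_const,
        Finset.card_univ, ZMod.card, nsmul_eq_mul] at this
      push_cast at this
      linarith
    have h0 := (mul_eq_zero.1 hsum).resolve_left (sub_ne_zero.2 hμ.2)
    funext i
    have hi : (μ ^ 2 - 2) * u i = 0 := by
      have := hu i
      rw [h0] at this
      linarith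
    exact (mul_eq_zero.1 hi).resolve_left (sub_ne_zero.2 hμ.1)
  have hsum : ∀ (u : ZMod 7 → ℝ) (i : ZMod 7),
      ∑ k, u k = u i + u (i + 1) + u (i + 2) + u (i + 3) + u (i + 4) + u (i + 5) + u (i + 6) := by
    intro u i
    rw [← Equiv.sum_comp (Equiv.addLeft i)]
    have h0 : u (i + 0) = u i := by rw [add_zero]
    rw [← h0]
    exact Fin.sum_univ_seven (fun k : Fin 7 => u ((Equiv.addLeft i) k))
  refine h ⟨key a fun i => ?_, key b fun j => ?_⟩
  · have e1 := hb (i - 1)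
    have e2 := hb (i - 3)
    rw [show ∀ k : ZMod 7, k - 1 + 1 = k by decide, show ∀ k : ZMod 7, k - 1 + 3 = k + 2 by decide,
      show ∀ k : ZMod 7, a (k - 1) = a (k + 6) from fun k => congrArg a (by revert k; decide)] at e1
    rw [show ∀ k : ZMod 7, k - 3 + 1 = k + 5 by decide, show ∀ k : ZMod 7, k - 3 + 3 = k by decide,
      show ∀ k : ZMod 7, a (k - 3) = a (k + 4) from fun k => congrArg a (by revert k; decide)] at e2
    linear_combination μ * ha i + hb i + e1 + e2 - hsum a i
  · have e1 := ha j
    have e2 := ha (j + 1)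
    have e3 := ha (j + 3)
    rw [show ∀ k : ZMod 7, k - 1 = k + 6 by decide, show ∀ k : ZMod 7, k - 3 = k + 4 by decide]
      at e1
    rw [show ∀ k : ZMod 7, k + 1 - 1 = k by decide, show ∀ k : ZMod 7, k + 1 - 3 = k + 5 by decide]
      at e2
    rw [show ∀ k : ZMod 7, k + 3 - 1 = k + 2 by decide, show ∀ k : ZMod 7, k + 3 - 3 = k by decide]
      at e3
    linear_combination μ * hb j + e1 + e2 + e3 - hsum b j

omit [DecidableEq V] in
-- An eigenvector restricts to a solution of the eigenvalue equations on a component where it does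
-- not vanish.
theorem sq_eigenvalue_of_iso_heawoodGraph
    (h : ∀ C : G.ConnectedComponent, Nonempty (C.toSimpleGraph ≃g heawoodGraph))
    {x : V → ℝ} (hx : x ≠ 0) {μ : ℝ} (hμ : (G.adjMatrix ℝ).mulVec x = μ • x) :
    μ ^ 2 = 2 ∨ μ ^ 2 = 9 := by
  obtain ⟨v, hv⟩ := Function.ne_iff.1 hx
  set C := G.connectedComponentMk v with hC
  obtain ⟨φ⟩ := h C
  have hmem : v ∈ C.supp := rfl
  set y : ZMod 7 ⊕ ZMod 7 → ℝ := fun s => x (φ.symm s).1 with hy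
  have hsum : ∀ s, ∀ t : Finset (ZMod 7 ⊕ ZMod 7), (∀ r, heawoodGraph.Adj s r ↔ r ∈ t) →
      μ * y s = ∑ r ∈ t, y r := by
    intro s t ht
    have := congrFun hμ (φ.symm s).1
    rw [adjMatrix_mulVec_apply, Pi.smul_apply, smul_eq_mul] at this
    rw [hy, ← this]
    symm
    refine Finset.sum_bij (fun r _ => (φ.symm r).1) (fun r hr => ?_) (fun r _ r' _ hrr => ?_)
      (fun w hw => ?_) fun _ _ => rfl
    · rw [mem_neighborFinset]
      exact φ.symm.map_adj_iff.2 ((ht r).2 hr)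
    · exact φ.symm.injective (Subtype.ext hrr)
    · rw [mem_neighborFinset] at hw
      have hwC : w ∈ C.supp := by
        have h1 : (φ.symm s).1 ∈ C.supp := (φ.symm s).2
        rw [ConnectedComponent.mem_supp_iff] at h1 ⊢
        rw [← h1]
        exact ConnectedComponent.sound hw.symm.reachable
      refine ⟨φ ⟨w, hwC⟩, (ht _).1 ?_, by simp⟩
      rw [← φ.symm.map_adj_iff, RelIso.symm_apply_apply]
      exact hw
  refine sq_eq_of_heawood_equations (a := fun i => y (Sum.inl i)) (b := fun j => y (Sum.inr j))
    (fun i => ?_) (fun j => ?_) ?_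
  · rw [hsum (Sum.inl i) {Sum.inr i, Sum.inr (i - 1), Sum.inr (i - 3)}]
    · rw [Finset.sum_insert, Finset.sum_insert, Finset.sum_singleton, add_assoc]
      all_goals
        revert i
        decide
    · rintro (r | r)
      · simp [heawoodGraph]
      · simp only [heawoodGraph, Finset.mem_insert, Finset.mem_singleton, Sum.inr.injEq]
        clear hsum hy
        revert i r
        decide
  · rw [hsum (Sum.inr j) {Sum.inl j, Sum.inl (j + 1), Sum.inl (j + 3)}]
    · rw [Finset.sum_insert, Finset.sum_insert, Finset.sum_singleton, add_assoc]
      all_goals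
        revert j
        decide
    · rintro (r | r)
      · simp [heawoodGraph]
      · simp [heawoodGraph]
  · rintro ⟨ha, hb⟩
    refine hv ?_
    have hv' : x v = y (φ ⟨v, hmem⟩) := by simp [hy]
    rw [hv', Pi.zero_apply]
    rcases φ ⟨v, hmem⟩ with i | j
    · exact congrFun ha i
    · exact congrFun hb j

theorem map_sqSubOne : G.sqSubOne.map (Int.cast : ℤ → ℝ) =
    G.adjMatrix ℝ ^ 2 - (1 : ℝ) • (1 : Matrix V V ℝ) := by
  ext u v
  rw [one_smul, pow_two, Matrix.map_apply, sqSubOne, Matrix.sub_apply, Matrix.sub_apply,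
    adjMatrix_mul_apply, adjMatrix_mul_apply]
  by_cases h : u = v <;> simp [Matrix.one_apply, h, adjMatrix_apply]

end SimpleGraph

/-! ### Conclusion. -/

theorem theorem2 {V : Type*} [Fintype V] [DecidableEq V] [Nonempty V]
    (G : SimpleGraph V) [DecidableRel G.Adj]
    (hbip : G.IsBipartite) (hdeg : G.maxDegree ≤ 3) :
    ((∀ C : G.ConnectedComponent, Nonempty (C.toSimpleGraph ≃g heawoodGraph)) →
      G.hlIndex = √2 ∧ G.medianH = √2 ∧ |G.medianL| = √2) ∧
    ((¬ ∀ C : G.ConnectedComponent, Nonempty (C.toSimpleGraph ≃g heawoodGraph)) →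
      G.medianH ∈ Set.Icc (-1 : ℝ) 1 ∧ G.medianL ∈ Set.Icc (-1 : ℝ) 1 ∧ G.hlIndex ≤ 1) := by
  have hdeg' : ∀ v, G.degree v ≤ 3 := fun v => (G.degree_le_maxDegree v).trans hdeg
  obtain ⟨h0, hL, ⟨i, hi⟩, hmin⟩ := hbip.median_spec
  have hA := SimpleGraph.isHermitian_adjMatrix (R := ℝ) G
  have hidx : G.hlIndex = G.medianH := by
    rw [SimpleGraph.hlIndex, hL, abs_neg, max_self, abs_of_nonneg h0]
  have hlt : ∀ {r : ℝ}, 0 ≤ r → r < G.medianH → ∀ j, r ^ 2 < hA.eigenvalues j ^ 2 := by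
    intro r hr hrm j
    rw [sq_lt_sq, abs_of_nonneg hr]
    exact hrm.trans_le (hmin j)
  refine ⟨fun h => ?_, fun h => ?_⟩
  · have hsq : G.medianH ^ 2 = 2 ∨ G.medianH ^ 2 = 9 := by
      refine SimpleGraph.sq_eigenvalue_of_iso_heawoodGraph h (x := ⇑(hA.eigenvectorBasis i)) ?_ ?_
      · intro hzero
        refine hA.eigenvectorBasis.orthonormal.ne_zero i ?_
        ext v
        exact congrFun hzero v
      · rw [hA.mulVec_eigenvectorBasis, hi]
    have hm : G.medianH = √2 := by
      rcases hsq with hsq | hsq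
      · rw [← hsq, Real.sqrt_sq h0]
      · exfalso
        -- If every eigenvalue exceeded `2` in modulus, `A ^ 2 - 4` would be positive definite, but
        -- its diagonal entries are `deg - 4 < 0`.
        have h2 : 2 < G.medianH := by nlinarith
        have hpd := hA.posDef_sq_sub_of_eigenvalues (hlt zero_le_two h2)
        obtain ⟨v⟩ := ‹Nonempty V›
        have hpos := hpd.diag_pos (i := v)
        rw [pow_two, Matrix.sub_apply, SimpleGraph.adjMatrix_mul_self_apply_self, Matrix.smul_apply,
          Matrix.one_apply_eq] at hpos
        have hv := hdeg' v
        norm_num at hpos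
        omega
    rw [hidx, hL, abs_neg, hm, abs_of_nonneg (Real.sqrt_nonneg 2)]
    exact ⟨rfl, rfl, rfl⟩
  · have hm : G.medianH ≤ 1 := by
      by_contra! hm
      refine h (SimpleGraph.nonempty_iso_heawoodGraph_of_posDef hbip hdeg' ?_)
      rw [SimpleGraph.map_sqSubOne]
      have := hA.posDef_sq_sub_of_eigenvalues (hlt zero_le_one hm)
      rwa [one_pow] at this
    rw [hidx, hL]
    exact ⟨⟨by linarith, hm⟩, ⟨by linarith, by linarith⟩, hm⟩
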